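/- Let $\mu_d$ be Lebesgue measure on $\mathbb{R}^d$, and let $D\subset\mathbb{R}^d$ be a non-empty compact set with $\overline{D^\circ}=D$ and $\mu_d(\partial D)=0$. Let $\mathcal{F}=\{f_1,\dots,f_k\}$ be a finite family of injective contractions $\mathbb{R}^d\to\mathbb{R}^d$ (each Lipschitz with some constant $<1$), and put $\Phi(X)=\bigcup_{i=1}^k f_i(X)$. Suppose that $f_i(D)\subset D$ for all $i$ and $\mu_d(f_i(D)\cap f_j(D))=0$ for all $i\neq j$. Let $E$ be the attractor of $\mathcal{F}$, i.e. the non-empty compact set with $E=\Phi(E)$, and assume $\mu_d(E)=0$. A compact set $X\subset\mathbb{R}^d$ is said to generate a dissection of $D$ with respect to $\mathcal{F}$ if $\overline{X^\circ}=X$, $D=X\cup\Phi(X)$, $\mu_d(f_i(X)\cap f_j(X))=0$ for all $i\ne j$, and $\mu_d(X\cap f_i(X))=0$ for all $i$. Put $A=\overline{D\setminus\Phi(D)}\cup E$. Then $\big(\{f\circ g: f,g\in\mathcal{F}\},A\big)$ is an IFS with condensation (that is, the maps $f\circ g$ form a finite family of contractions and $A$ is non-empty and compact). There is exactly one set $X$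 that generates a dissection of $D$ with respect to $\mathcal{F}$, and this $X$ is the attractor of this IFS with condensation: $X$ is the unique non-empty compact set $K\subset\mathbb{R}^d$ satisfying $$K=A\cup\bigcup_{f,g\in\mathcal{F}} f(g(K)).$$ -/

import Mathlib

open Set MeasureTheory

/-- The set map `Φ(X) = ⋃ i, f i (X)` of a family of self-maps. -/
def familyImage {d : ℕ} {ι : Type} (f : ι → EuclideanSpace ℝ (Fin d) → EuclideanSpace ℝ (Fin d))
    (X : Set (EuclideanSpace ℝ (Fin d))) : Set (EuclideanSpace ℝ (Fin d)) :=
  ⋃ i, f i '' X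

/-- An iterated function system: a finite family of contractions of `ℝ^d`
(each Lipschitz with some constant `< 1`). -/
def IsIFS {d : ℕ} {ι : Type}
    (f : ι → EuclideanSpace ℝ (Fin d) → EuclideanSpace ℝ (Fin d)) : Prop :=
  Finite ι ∧ ∀ i, ∃ c : NNReal, ContractingWith c (f i)

/-- `K` is a non-empty compact solution of `K = Φ(K)`. -/
def IsAttractor {d : ℕ} {ι : Type}
    (f : ι → EuclideanSpace ℝ (Fin d) → EuclideanSpace ℝ (Fin d))
    (K : Set (EuclideanSpace ℝ (Fin d))) : Prop :=
  K.Nonempty ∧ IsCompact K ∧ K = familyImage f K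

/-- `(f, A)` is an IFS with condensation: `f` is an IFS and `A` is non-empty and compact. -/
def IsCondensationIFS {d : ℕ} {ι : Type}
    (f : ι → EuclideanSpace ℝ (Fin d) → EuclideanSpace ℝ (Fin d))
    (A : Set (EuclideanSpace ℝ (Fin d))) : Prop :=
  IsIFS f ∧ A.Nonempty ∧ IsCompact A

/-- `K` is a non-empty compact solution of `K = A ∪ Φ(K)`. -/
def IsCondensationAttractor {d : ℕ} {ι : Type}
    (f : ι → EuclideanSpace ℝ (Fin d) → EuclideanSpace ℝ (Fin d))
    (A K : Set (EuclideanSpace ℝ (Fin d))) : Prop :=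
  K.Nonempty ∧ IsCompact K ∧ K = A ∪ familyImage f K

/-- `f i (D) ⊆ D` for every `i`. -/
def IsInsideFamily {d : ℕ} {ι : Type}
    (f : ι → EuclideanSpace ℝ (Fin d) → EuclideanSpace ℝ (Fin d))
    (D : Set (EuclideanSpace ℝ (Fin d))) : Prop :=
  ∀ i, f i '' D ⊆ D

/-- `f i (D)` and `f j (D)` overlap in a Lebesgue null set for `i ≠ j`. -/
def IsNonOverlappingFamily {d : ℕ} {ι : Type}
    (f : ι → EuclideanSpace ℝ (Fin d) → EuclideanSpace ℝ (Fin d))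
    (D : Set (EuclideanSpace ℝ (Fin d))) : Prop :=
  ∀ i j, i ≠ j → volume (f i '' D ∩ f j '' D) = 0

/-- `X` generates a dissection of `D` with respect to the family `f`. -/
def IsDissectionGenerator {d : ℕ} {ι : Type}
    (f : ι → EuclideanSpace ℝ (Fin d) → EuclideanSpace ℝ (Fin d))
    (D X : Set (EuclideanSpace ℝ (Fin d))) : Prop :=
  IsCompact X ∧ closure (interior X) = X ∧ D = X ∪ familyImage f X ∧
    (∀ i j, i ≠ j → volume (f i '' X ∩ f j '' X) = 0) ∧
    ∀ i, volume (X ∩ f i '' X) = 0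

/-- The family of all compositions `f i ∘ f j`. -/
def pairCompositions {d : ℕ} {ι : Type}
    (f : ι → EuclideanSpace ℝ (Fin d) → EuclideanSpace ℝ (Fin d)) :
    ι × ι → EuclideanSpace ℝ (Fin d) → EuclideanSpace ℝ (Fin d) :=
  fun p => f p.1 ∘ f p.2

/-! Write `B` for the closure of `D \ Φ(D)`. A generator `X'` contains `B`, because `D = X' ∪ Φ(X')`
and `Φ(X') ⊆ Φ(D)`. It also contains `Φ(Φ(X'))`: this set meets `Φ(X')` in a null set, so up to a
null set it lies in `X'`, and regular closedness removes the exception. Hence `X'` contains the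
least solution `X` of `K = B ∪ Φ(Φ(K))`. Conversely the interior of `X'` outside `X` lies in `X' ∩
Φ(X')`, which is null, so `X' = X`.

That `X` is a generator rests on the comparison principle `IsIFS.subset_of_subset_union` and on
`IsAttractor.volume_eq_zero_of_subset_union`: the overlap `X ∩ Φ(X)` lies in its own image up to a
null set, so iteration pushes it into the null set `E`. Adding `E` to `B` changes nothing, since `E
⊆ X` already; it only excludes other attractors.

Regularity of images and nullity of `B ∩ Φ(D)` need the maps to be open. This is invariance of
domain, derived from the no-retraction theorem, itself proved by comparing Jacobian integrals. -/

/-! ### Lipschitz perturbations of the identity -/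

/-- A Lipschitz function on a closed ball vanishing on the bounding sphere stays Lipschitz, with
the same constant, when extended by zero. -/
theorem LipschitzOnWith.indicator_closedBall {E F : Type*} [NormedAddCommGroup E] [NormedSpace ℝ E]
    [NormedAddCommGroup F] {g : E → F} {C : NNReal} {L : ℝ}
    (hg : LipschitzOnWith C g (Metric.closedBall 0 L)) (h0 : ∀ x, ‖x‖ = L → g x = 0) :
    LipschitzWith C (indicator (Metric.closedBall 0 L) g) := by
  have key : ∀ x y : E, ‖x‖ ≤ L → L < ‖y‖ → ‖g x‖ ≤ C * dist x y := by
    intro x y hx hy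
    -- The segment from `x` to `y` crosses the sphere, where `g` vanishes, no farther from `x` than
    -- `y` is.
    obtain ⟨t, ht, hz⟩ : L ∈ (fun t : ℝ => ‖AffineMap.lineMap x y t‖) '' Icc (0 : ℝ) 1 := by
      apply intermediate_value_Icc zero_le_one
      · exact (AffineMap.lineMap_continuous.norm).continuousOn
      · simpa using ⟨hx, hy.le⟩
    have h1 := hg.dist_le_mul x (by simpa using hx) (AffineMap.lineMap x y t) (by simp [← hz])
    rw [h0 _ hz, dist_zero_right, dist_left_lineMap, Real.norm_of_nonneg ht.1] at h1
    refine h1.trans (mul_le_mul_of_nonneg_left ?_ C.2)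
    exact mul_le_of_le_one_left dist_nonneg ht.2
  refine LipschitzWith.of_dist_le_mul fun x y => ?_
  by_cases hx : ‖x‖ ≤ L <;> by_cases hy : ‖y‖ ≤ L
  · rw [indicator_of_mem (by simpa using hx), indicator_of_mem (by simpa using hy)]
    exact hg.dist_le_mul x (by simpa using hx) y (by simpa using hy)
  · rw [indicator_of_mem (by simpa using hx), indicator_of_notMem (by simpa using hy),
      dist_zero_right]
    exact key x y hx (not_le.1 hy)
  · rw [indicator_of_mem (a := y) (by simpa using hy), indicator_of_notMem (by simpa using hx),
      dist_zero_left, dist_comm]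
    exact key y x hy (not_le.1 hx)
  · rw [indicator_of_notMem (by simpa using hx), indicator_of_notMem (by simpa using hy), dist_self]
    positivity

/-- A small Lipschitz perturbation of the identity supported in a set maps this set bijectively to
itself. -/
theorem LipschitzWith.bijOn_add_smul {E : Type*} [NormedAddCommGroup E] [NormedSpace ℝ E]
    [CompleteSpace E] {G : E → E} {C : NNReal} (hG : LipschitzWith C G) {s : Set E}
    (h0 : ∀ x ∉ s, G x = 0) {t : ℝ} (ht0 : 0 ≤ t) (ht : t * C < 1) :
    BijOn (fun x => x + t • G x) s s := by
  have hinj : Function.Injective (fun x => x + t • G x) := by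
    intro x y hxy
    have h1 : x - y = t • (G y - G x) := by
      rw [smul_sub, sub_eq_sub_iff_add_eq_add, add_comm _ y]
      exact hxy
    have h2 : ‖x - y‖ ≤ t * C * ‖x - y‖ := by
      calc ‖x - y‖ = t * ‖G y - G x‖ := by rw [h1, norm_smul, Real.norm_of_nonneg ht0]
        _ ≤ t * (C * ‖x - y‖) := by
          gcongr
          rw [norm_sub_rev x y]
          exact hG.norm_sub_le y x
        _ = _ := by ring
    have h3 : ‖x - y‖ ≤ 0 := by nlinarith [norm_nonneg (x - y)]
    exact sub_eq_zero.1 (norm_le_zero_iff.1 h3)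
  have hout : ∀ x ∉ s, x + t • G x = x := fun x hx => by simp [h0 x hx]
  refine ⟨fun x hx => ?_, hinj.injOn, fun y hy => ?_⟩
  -- If the image of `x` were outside `s`, it would be fixed, and injectivity would make `x` equal
  -- to it.
  · by_contra hFx
    have := hinj (hout _ hFx)
    exact hFx (Eq.mpr (congrArg (· ∈ s) this) hx)
  · have hc : ContractingWith (t.toNNReal * C) (fun x => y - t • G x) := by
      refine ⟨?_, LipschitzWith.of_dist_le_mul fun a b => ?_⟩
      · rw [← NNReal.coe_lt_coe]; simpa [Real.coe_toNNReal t ht0] using ht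
      · rw [dist_sub_left, dist_smul₀, Real.norm_of_nonneg ht0]
        simp only [NNReal.coe_mul, Real.coe_toNNReal t ht0, mul_assoc]
        exact mul_le_mul_of_nonneg_left (hG.dist_le_mul a b) ht0
    have hfix : y - t • G hc.fixedPoint = hc.fixedPoint := hc.fixedPoint_isFixedPt
    have hF : hc.fixedPoint + t • G hc.fixedPoint = y := by
      nth_rewrite 1 [← hfix]; simp
    refine ⟨hc.fixedPoint, ?_, hF⟩
    by_contra hx
    rw [hout _ hx] at hF
    exact hx (hF.symm ▸ hy)

/-! ### Determinants near the identity -/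

section FiniteDimensional

variable {E : Type*} [NormedAddCommGroup E] [NormedSpace ℝ E] [FiniteDimensional ℝ E]

/-- By the Neumann series `1 + t • M` is invertible for all `t` in `[0, 1]`, so its determinant
cannot change sign from its value `1` at `t = 0`. -/
theorem ContinuousLinearMap.det_one_add_pos {M : E →L[ℝ] E} (hM : ‖M‖ < 1) :
    0 < (1 + M).det := by
  by_contra hneg
  have hcont : ContinuousOn (fun t : ℝ => (1 + t • M).det) (Icc 0 1) :=
    (ContinuousLinearMap.continuous_det.comp (by fun_prop)).continuousOn
  obtain ⟨t, ht, h0⟩ := intermediate_value_Icc' zero_le_one hcont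
    (show (0 : ℝ) ∈ Icc _ _ by
      refine ⟨by simpa using hneg, ?_⟩
      simp [ContinuousLinearMap.det])
  have hlt : ‖-(t • M)‖ < 1 := by
    rw [norm_neg, norm_smul, Real.norm_of_nonneg ht.1]
    nlinarith [norm_nonneg M, ht.1, ht.2]
  have hu : IsUnit (1 + t • M) := by
    have := isUnit_one_sub_of_norm_lt_one hlt
    simpa using this
  have h1 : IsUnit ((1 + t • M : E →L[ℝ] E) : E →ₗ[ℝ] E) :=
    hu.map ContinuousLinearMap.toLinearMapRingHom
  exact (LinearMap.isUnit_det _ h1).ne_zero h0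

/-- The determinant of `1 + M` as a fixed linear combination of determinants of `1 + t M` with
arbitrarily small `t`. -/
theorem ContinuousLinearMap.exists_det_one_add_eq_sum (E : Type*) [NormedAddCommGroup E]
    [NormedSpace ℝ E] [FiniteDimensional ℝ E] {ε : ℝ} (hε : 0 < ε) :
    ∃ (s : Finset ℝ) (w : ℝ → ℝ), (∀ t ∈ s, 0 < t ∧ t < ε) ∧
      ∀ M : E →L[ℝ] E, (1 + M).det = ∑ t ∈ s, w t * (1 + t • M).det := by
  -- The determinant is a polynomial in `t` of degree at most the dimension, so Lagrange
  -- interpolation at dimension plus one small nodes recovers its value at `t = 1`.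
  obtain ⟨s, hs, hcard⟩ := (Ioo_infinite hε).exists_subset_card_eq (Module.finrank ℝ E + 1)
  refine ⟨s, fun t => (Lagrange.basis s id t).eval 1, fun t ht => hs ht, fun M => ?_⟩
  let b := Module.finBasis ℝ E
  let A := LinearMap.toMatrix b b (M : E →ₗ[ℝ] E)
  let P : Polynomial ℝ := ((Polynomial.X : Polynomial ℝ) • A.map Polynomial.C +
    (1 : Matrix _ _ ℝ).map Polynomial.C).det
  have hP : ∀ t, P.eval t = (1 + t • M).det := by
    intro t
    have h1 : (1 + t • M).det = (1 + t • A).det := by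
      rw [ContinuousLinearMap.det, ← LinearMap.det_toMatrix b]
      congr 1
      simp [A, LinearMap.toMatrix_one]
    rw [h1]
    simp only [P]
    rw [← Polynomial.coe_evalRingHom, RingHom.map_det]
    congr 1
    ext i j
    simp only [Polynomial.coe_evalRingHom, RingHom.mapMatrix_apply, Matrix.map_apply, Matrix.add_apply,
      Matrix.smul_apply, Matrix.one_apply, smul_eq_mul, Polynomial.eval_add, Polynomial.eval_mul,
      Polynomial.eval_X, Polynomial.eval_C]
    ring
  have hdeg : P.degree < (s.card : ℕ) := by
    refine lt_of_le_of_lt Polynomial.degree_le_natDegree ?_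
    have := Polynomial.natDegree_det_X_add_C_le A 1
    rw [Fintype.card_fin] at this
    rw [hcard]
    exact_mod_cast Nat.lt_succ_of_le this
  have h2 := Lagrange.eq_interpolate (s := s) (v := id) (injOn_id _) hdeg
  have h3 := congrArg (Polynomial.eval 1) h2
  rw [hP, one_smul, Lagrange.interpolate_apply, Polynomial.eval_finsetSum] at h3
  rw [h3]
  refine Finset.sum_congr rfl fun t _ => ?_
  simp [hP, mul_comm]

end FiniteDimensional

/-! ### No-retraction theorem and zeros of maps near the identity -/

section Brouwer

variable {E : Type*} [NormedAddCommGroup E] [InnerProductSpace ℝ E] [FiniteDimensional ℝ E]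

/-- Differentiating the constant `‖r‖ ^ 2` shows that `r x` is orthogonal to the range of `r'`; a
surjective `r'` would force `r x = 0`. -/
theorem det_fderiv_eq_zero_of_norm_eq {r : E → E} {r' : E →L[ℝ] E} {x : E} {L : ℝ} (hL : 0 < L)
    (hr : HasFDerivAt r r' x) (hn : ∀ᶠ y in nhds x, ‖r y‖ = L) : r'.det = 0 := by
  by_contra hdet
  have h1 : HasFDerivAt (fun y => ‖r y‖ ^ 2) (2 • (innerSL ℝ (r x)).comp r') x := hr.norm_sq
  have h2 : HasFDerivAt (fun y => ‖r y‖ ^ 2) (0 : E →L[ℝ] ℝ) x :=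
    (hasFDerivAt_const (L ^ 2) x).congr_of_eventuallyEq (hn.mono fun y hy => by simp [hy])
  have h3 := h1.unique h2
  have hsurj : Function.Surjective (r' : E →ₗ[ℝ] E) :=
    (LinearMap.equivOfDetNeZero (r' : E →ₗ[ℝ] E) hdet).surjective
  obtain ⟨v, hv⟩ := hsurj (r x)
  have h4 := congrArg (fun φ : E →L[ℝ] ℝ => φ v) h3
  have hv' : r' v = r x := hv
  simp [hv'] at h4
  have h5 := hn.self_of_nhds
  rw [h4, norm_zero] at h5
  exact hL.ne h5

/-- There is no `C¹` retraction of a closed ball onto its bounding sphere. -/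
theorem no_contDiff_retraction {r : E → E} (hr : ContDiff ℝ 1 r) {L : ℝ} (hL : 0 < L)
    (hn : ∀ x, ‖x‖ ≤ L → ‖r x‖ = L) (hid : ∀ x, ‖x‖ = L → r x = x) : False := by
  borelize E
  let μ : Measure E := Measure.addHaar
  obtain ⟨C, hC⟩ := (hr.sub contDiff_id).contDiffOn.exists_lipschitzOnWith one_ne_zero
    (convex_closedBall (0 : E) L) (isCompact_closedBall (0 : E) L)
  have hG := hC.indicator_closedBall (fun x hx => by simp [hid x hx])
  set G := indicator (Metric.closedBall (0 : E) L) (fun x => r x - id x) with hGdef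
  have hG0 : ∀ x ∉ Metric.ball (0 : E) L, G x = 0 := by
    intro x hx
    by_cases hx' : ‖x‖ = L
    · rw [hGdef, indicator_of_mem (by simp [hx'])]
      simp [hid x hx']
    · rw [hGdef, indicator_of_notMem]
      simp only [Metric.mem_ball, dist_zero_right, not_lt, mem_closedBall_zero_iff, not_le] at hx ⊢
      exact lt_of_le_of_ne hx (Ne.symm hx')
  have hrd : ∀ x, HasFDerivAt r (fderiv ℝ r x) x := fun x =>
    (hr.differentiable one_ne_zero x).hasFDerivAt
  have hGd : ∀ x ∈ Metric.ball (0 : E) L, HasFDerivAt G (fderiv ℝ r x - 1) x := by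
    intro x hx
    have h1 : HasFDerivAt (fun x => r x - id x) (fderiv ℝ r x - 1) x := (hrd x).sub (hasFDerivAt_id x)
    refine h1.congr_of_eventuallyEq ?_
    filter_upwards [Metric.isOpen_ball.mem_nhds hx] with y hy
    exact indicator_of_mem (Metric.ball_subset_closedBall hy) _
  have hGn : ∀ x ∈ Metric.ball (0 : E) L, ‖fderiv ℝ r x - 1‖ ≤ C := fun x hx =>
    (hGd x hx).le_of_lipschitz hG
  have hC1 : (0 : ℝ) < C + 1 := by positivity
  obtain ⟨s, w, hs, hw⟩ := ContinuousLinearMap.exists_det_one_add_eq_sum E (inv_pos.2 hC1)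
  have hsC : ∀ t ∈ s, t * C < 1 := by
    intro t ht
    have h1 := (hs t ht).2
    have h2 : t * (C + 1) < 1 := by rwa [lt_inv_comm₀ (hs t ht).1 hC1, ← one_div,
      lt_div_iff₀ (hs t ht).1, mul_comm] at h1
    nlinarith [(hs t ht).1]
  have hcont : ∀ t : ℝ, Continuous fun x => (1 + t • (fderiv ℝ r x - 1)).det := fun t =>
    ContinuousLinearMap.continuous_det.comp
      (continuous_const.add (((hr.continuous_fderiv one_ne_zero).sub continuous_const).const_smul t))
  have hint : ∀ t : ℝ, IntegrableOn (fun x => (1 + t • (fderiv ℝ r x - 1)).det)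
      (Metric.ball 0 L) μ := fun t =>
    ((hcont t).continuousOn.integrableOn_compact (isCompact_closedBall (0 : E) L)).mono_set
      Metric.ball_subset_closedBall
  -- For small `t` the perturbed identity permutes the ball with positive Jacobian, so change of
  -- variables gives the volume. Interpolation carries this to `t = 1`, where the Jacobian of `r`
  -- vanishes.
  have hvol : ∀ t ∈ s, ∫ x in Metric.ball (0 : E) L, (1 + t • (fderiv ℝ r x - 1)).det ∂μ =
      μ.real (Metric.ball 0 L) := by
    intro t ht
    have hb := hG.bijOn_add_smul hG0 (hs t ht).1.le (hsC t ht)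
    have h1 := integral_image_eq_integral_abs_det_fderiv_smul μ (Metric.isOpen_ball.measurableSet)
      (f' := fun x => 1 + t • (fderiv ℝ r x - 1))
      (fun x hx => ((hasFDerivAt_id x).add ((hGd x hx).const_smul t)).hasFDerivWithinAt)
      hb.injOn (fun _ => (1 : ℝ))
    have himg := hb.image_eq
    simp only [Pi.add_def, Pi.smul_def, id] at h1
    rw [himg] at h1
    simp only [smul_eq_mul, mul_one, integral_const, MeasurableSet.univ, measureReal_restrict_apply,
      univ_inter] at h1
    rw [h1]
    refine setIntegral_congr_fun Metric.isOpen_ball.measurableSet fun x hx => ?_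
    refine (abs_of_pos (ContinuousLinearMap.det_one_add_pos ?_)).symm
    rw [norm_smul, Real.norm_of_nonneg (hs t ht).1.le]
    exact (mul_le_mul_of_nonneg_left (hGn x hx) (hs t ht).1.le).trans_lt (hsC t ht)
  have hsum : ∑ t ∈ s, w t = 1 := by
    have := hw 0
    simp only [smul_zero, add_zero, ContinuousLinearMap.det] at this
    simpa using this.symm
  have h1 : ∫ x in Metric.ball (0 : E) L, (fderiv ℝ r x).det ∂μ = μ.real (Metric.ball 0 L) := by
    have : ∀ x, (fderiv ℝ r x).det = ∑ t ∈ s, w t * (1 + t • (fderiv ℝ r x - 1)).det := fun x => by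
      rw [← hw]; simp
    simp_rw [this]
    rw [integral_finsetSum _ fun t _ => (hint t).const_mul (w t)]
    simp_rw [integral_const_mul]
    rw [Finset.sum_congr rfl fun t ht => by rw [hvol t ht], ← Finset.sum_mul, hsum, one_mul]
  have h2 : ∫ x in Metric.ball (0 : E) L, (fderiv ℝ r x).det ∂μ = 0 := by
    refine setIntegral_eq_zero_of_forall_eq_zero fun x hx => ?_
    refine det_fderiv_eq_zero_of_norm_eq hL (hrd x) ?_
    filter_upwards [Metric.isOpen_ball.mem_nhds hx] with y hy
    exact hn y (by simpa using (Metric.ball_subset_closedBall hy))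
  have h3 : 0 < μ.real (Metric.ball (0 : E) L) :=
    ENNReal.toReal_pos (Metric.measure_ball_pos μ 0 hL).ne' measure_ball_lt_top.ne
  rw [h2] at h1
  exact h3.ne h1

/-- A continuous self-map of a Euclidean space that is the identity outside a ball has a zero. -/
theorem exists_eq_zero_of_eq_id_outside {h : E → E} (hc : Continuous h) {R : ℝ} (hR : 0 < R)
    (hid : ∀ x, R ≤ ‖x‖ → h x = x) : ∃ x, h x = 0 := by
  by_contra! hne
  obtain ⟨δ, hδ, hδh⟩ : ∃ δ > 0, ∀ x, δ ≤ ‖h x‖ := by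
    obtain ⟨x₀, -, hx₀⟩ := (isCompact_closedBall (0 : E) R).exists_isMinOn
      ⟨0, by simp [hR.le]⟩ hc.norm.continuousOn
    refine ⟨min ‖h x₀‖ R, lt_min (norm_pos_iff.2 (hne _)) hR, fun x => ?_⟩
    by_cases hx : ‖x‖ ≤ R
    · exact (min_le_left _ _).trans (hx₀ (by simpa using hx))
    · rw [hid x (not_le.1 hx).le]
      exact (min_le_right _ _).trans (not_le.1 hx).le
  have hgc : Continuous fun x => h x - x := hc.sub continuous_id
  have hsupp : HasCompactSupport fun x => h x - x :=
    HasCompactSupport.intro (isCompact_closedBall (0 : E) R) fun x hx => by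
      rw [hid x (by simpa using (not_le.1 (by simpa using hx)).le), sub_self]
  obtain ⟨η, hη, hηg⟩ := Metric.uniformContinuous_iff.1
    (hsupp.uniformContinuous_of_continuous hgc) (δ / 2) (half_pos hδ)
  obtain ⟨q, hq, hqg⟩ := hgc.exists_contDiff_dist_le_of_forall_mem_ball_dist_le hη
  have hq0 : ∀ x, R + η ≤ ‖x‖ → q x = 0 := by
    intro x hx
    have hx' : h x - x = 0 := by rw [hid x (by linarith), sub_self]
    have := hqg x 0 fun y hy => by
      have hy' : ‖x‖ - ‖y‖ < η :=
        (norm_sub_norm_le x y).trans_lt (by simpa [dist_eq_norm, norm_sub_rev] using hy)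
      rw [hx', hid y (by linarith), sub_self, dist_self]
    rw [hx'] at this
    exact dist_le_zero.1 this
  have hk : ∀ x, x + q x ≠ 0 := by
    intro x hx
    have h1 := hqg x (δ / 2) fun y hy => (hηg hy).le
    have h2 : h x = -(q x - (h x - x)) := by
      rw [eq_neg_of_add_eq_zero_right hx]; abel
    have h3 := hδh x
    rw [h2, norm_neg, ← dist_eq_norm] at h3
    linarith
  have hL : 0 < R + η := by positivity
  have hq1 : ContDiff ℝ 1 fun x => x + q x := contDiff_id.add (hq.of_le (by exact_mod_cast le_top))
  -- A smooth approximation without zeros, projected radially to the sphere, is a forbidden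
  -- retraction.
  refine no_contDiff_retraction (r := fun x => ((R + η) / ‖x + q x‖) • (x + q x)) ?_ hL ?_ ?_
  · exact (contDiff_const.div (hq1.norm ℝ hk) fun x => norm_ne_zero_iff.2 (hk x)).smul hq1
  · intro x _
    rw [norm_smul, norm_div, norm_norm, Real.norm_of_nonneg hL.le,
      div_mul_cancel₀ _ (norm_ne_zero_iff.2 (hk x))]
  · intro x hx
    simp [hq0 x hx.ge, hx, hL.ne']

/-- A continuous map on the closed unit ball at distance less than one from the identity has a
zero. -/
theorem exists_eq_zero_of_norm_sub_lt_one {u : E → E}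
    (hu : ContinuousOn u (Metric.closedBall 0 1))
    (hlt : ∀ x ∈ Metric.closedBall (0 : E) 1, ‖u x - x‖ < 1) :
    ∃ x ∈ Metric.closedBall (0 : E) 1, u x = 0 := by
  let P : E → E := fun x => (max 1 ‖x‖)⁻¹ • x
  have hpos : ∀ x : E, 0 < max 1 ‖x‖ := fun x => lt_max_of_lt_left one_pos
  have hPc : Continuous P :=
    ((continuous_const.max continuous_norm).inv₀ fun x => (hpos x).ne').smul continuous_id
  have hPm : ∀ x, P x ∈ Metric.closedBall (0 : E) 1 := by
    intro x
    simp only [P, mem_closedBall_zero_iff, norm_smul, norm_inv, Real.norm_of_nonneg (hpos x).le]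
    exact inv_mul_le_one_of_le₀ (le_max_right _ _) (hpos x).le
  have hPid : ∀ x, ‖x‖ ≤ 1 → P x = x := fun x hx => by simp [P, max_eq_left hx]
  have hwc : Continuous fun x => u (P x) - P x := (hu.comp_continuous hPc hPm).sub hPc
  -- The cutoff is `1` on the unit ball and `0` beyond radius `2`; since the displacement is shorter
  -- than `1`, any zero lies in the unit ball.
  obtain ⟨x, hx⟩ := exists_eq_zero_of_eq_id_outside
    (h := fun x => x + (max 0 (min 1 (2 - ‖x‖))) • (u (P x) - P x)) (R := 2)
    (by fun_prop) two_pos (fun x hx => by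
      rw [max_eq_left ((min_le_right _ _).trans (by linarith)), zero_smul, add_zero])
  have hx1 : ‖x‖ ≤ 1 := by
    rw [eq_neg_of_add_eq_zero_left hx, norm_neg, norm_smul, Real.norm_of_nonneg (le_max_left _ _)]
    exact mul_le_one₀ (max_le zero_le_one (min_le_left _ _)) (norm_nonneg _) (hlt _ (hPm x)).le
  refine ⟨x, by simpa using hx1, ?_⟩
  have h1 : max 0 (min 1 (2 - ‖x‖)) = 1 := by
    rw [min_eq_left (by linarith), max_eq_right zero_le_one]
  simpa [h1, hPid x hx1] using hx

end Brouwer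

/-! ### Invariance of domain -/

section InvarianceOfDomain

variable {E : Type*} [NormedAddCommGroup E] [InnerProductSpace ℝ E] [FiniteDimensional ℝ E]

/-- A left inverse `G` of `f` on the closed unit ball has a zero on the image even after
a perturbation of size less than one. -/
theorem exists_perturbed_inverse_eq_zero {f G : E → E} (hf : Continuous f)
    (hG : ∀ x ∈ Metric.closedBall (0 : E) 1, ‖G (f x) - x‖ < 1)
    (hGc : ContinuousOn G (f '' Metric.closedBall 0 1)) :
    ∃ y ∈ f '' Metric.closedBall 0 1, G y = 0 := by
  obtain ⟨x, hx, h0⟩ := exists_eq_zero_of_norm_sub_lt_one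
    (hGc.comp hf.continuousOn (mapsTo_image _ _)) hG
  exact ⟨f x, mem_image_of_mem f hx, h0⟩

/-- If `f 0` were not interior, the inverse of `f`, extended by Tietze's theorem, could be perturbed
by less than one so as to lose all its zeros on the image, against
`exists_perturbed_inverse_eq_zero`. -/
theorem mem_interior_image_closedBall_one {f : E → E} (hf : Continuous f)
    (hinj : Function.Injective f) : f 0 ∈ interior (f '' Metric.closedBall 0 1) := by
  borelize E
  let μ : Measure E := Measure.addHaar
  set B := f '' Metric.closedBall (0 : E) 1 with hB
  have hBc : IsCompact B := (isCompact_closedBall (0 : E) 1).image hf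
  obtain ⟨G, hGf⟩ : ∃ G : C(E, E), ∀ x ∈ Metric.closedBall (0 : E) 1, G (f x) = x := by
    have : CompactSpace (Metric.closedBall (0 : E) 1) :=
      isCompact_iff_compactSpace.1 (isCompact_closedBall 0 1)
    have he : Topology.IsClosedEmbedding fun x : Metric.closedBall (0 : E) 1 => f x :=
      (hf.comp continuous_subtype_val).isClosedEmbedding (hinj.comp Subtype.val_injective)
    obtain ⟨G, hG⟩ := ContinuousMap.exists_extension' he
      (⟨Subtype.val, continuous_subtype_val⟩ : C(Metric.closedBall (0 : E) 1, E))
    exact ⟨G, fun x hx => congrFun hG ⟨x, hx⟩⟩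
  by_contra hint
  have hG0 : G (f 0) = 0 := hGf 0 (by simp)
  -- With `1 / 10` here and for the later errors, four terms add up to less than `1`.
  obtain ⟨ε, hε, hεG⟩ := Metric.continuous_iff.1 G.continuous (f 0) (1 / 10) (by norm_num)
  rw [hG0] at hεG
  simp only [dist_zero_right] at hεG
  have hε2 : 0 < ε / 2 := half_pos hε
  obtain ⟨c, hcε, hcB⟩ : ∃ c, dist c (f 0) < ε / 2 ∧ c ∉ B := by
    by_contra! hall
    exact hint (mem_interior_iff_mem_nhds.2 (Metric.mem_nhds_iff.2 ⟨ε / 2, hε2, fun c hc => hall c hc⟩))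
  have hnear : ∀ y, dist y c ≤ ε / 2 → ‖G y‖ < 1 / 10 := fun y hy =>
    hεG y ((dist_triangle y c (f 0)).trans_lt (by linarith))
  -- lower bound for `G` on the part of the image away from `c`
  obtain ⟨δ, hδ, hδG⟩ : ∃ δ > 0, ∀ y ∈ B, ε / 2 ≤ dist y c → δ ≤ ‖G y‖ := by
    have hS : IsCompact (B ∩ {y | ε / 2 ≤ dist y c}) :=
      hBc.inter_right (isClosed_le continuous_const (continuous_id.dist continuous_const))
    rcases (B ∩ {y | ε / 2 ≤ dist y c}).eq_empty_or_nonempty with he | hne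
    · refine ⟨1, one_pos, fun y hy hyc => ?_⟩
      have : y ∈ B ∩ {y | ε / 2 ≤ dist y c} := ⟨hy, hyc⟩
      rw [he] at this
      exact this.elim
    · obtain ⟨y₀, ⟨hy₀, hy₀c⟩, hmin⟩ := hS.exists_isMinOn hne G.continuous.norm.continuousOn
      refine ⟨‖G y₀‖, norm_pos_iff.2 ?_, fun y hy hyc => hmin ⟨hy, hyc⟩⟩
      obtain ⟨x, hx, rfl⟩ := hy₀
      rw [hGf x hx]
      rintro rfl
      rw [mem_ofPred_eq, dist_comm] at hy₀c
      linarith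
  -- a smooth approximation missing zero on the sphere around `c`
  have hη : 0 < min (δ / 2) (1 / 10) := lt_min (half_pos hδ) (by norm_num)
  set K := B ∪ Metric.closedBall c (ε / 2) with hK
  have hKc : IsCompact K := hBc.union (isCompact_closedBall c (ε / 2))
  obtain ⟨Q, hQs, hQG⟩ : ∃ Q : E → E, ContDiff ℝ 1 Q ∧
      ∀ y ∈ K, dist (Q y) (G y) < min (δ / 2) (1 / 10) := by
    have huc := (hKc.cthickening (r := 1)).uniformContinuousOn_of_continuous
      G.continuous.continuousOn
    obtain ⟨ρ, hρ, hρG⟩ := Metric.uniformContinuousOn_iff.1 huc _ (half_pos hη)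
    obtain ⟨Q, hQs, hQ⟩ := G.continuous.exists_contDiff_dist_le_of_forall_mem_ball_dist_le
      (lt_min hρ one_pos)
    refine ⟨Q, hQs.of_le (by exact_mod_cast le_top), fun y hy => ?_⟩
    refine (hQ y _ fun z hz => (hρG z ?_ y ?_ ?_).le).trans_lt (half_lt_self hη)
    · exact Metric.mem_cthickening_of_dist_le z y 1 K hy
        ((Metric.mem_ball.1 hz).le.trans (min_le_right _ _))
    · exact Metric.self_subset_cthickening K hy
    · exact (Metric.mem_ball.1 hz).trans_le (min_le_left _ _)
  -- The `C¹` map `Q` sends the null sphere to a null set, so some small `v` is missed.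
  obtain ⟨v, hv, hvQ⟩ : ∃ v, ‖v‖ < min (δ / 2) (1 / 10) ∧ v ∉ Q '' Metric.sphere c (ε / 2) := by
    have h0 : μ (Q '' Metric.sphere c (ε / 2)) = 0 :=
      addHaar_image_eq_zero_of_differentiableOn_of_addHaar_eq_zero μ
        (hQs.differentiable one_ne_zero).differentiableOn
        (Measure.addHaar_sphere_of_ne_zero μ c hε2.ne')
    by_contra! hall
    have : Metric.ball (0 : E) (min (δ / 2) (1 / 10)) ⊆ Q '' Metric.sphere c (ε / 2) :=
      fun v hv => hall v (by simpa using hv)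
    exact (Metric.measure_ball_pos μ (0 : E) hη).ne' (measure_mono_null this h0)
  -- push the image out of the ball around `c`
  let Φ : E → E := fun y => c + (max 1 (ε / 2 / ‖y - c‖)) • (y - c)
  have hyc0 : ∀ y ∈ B, 0 < ‖y - c‖ := fun y hy =>
    norm_pos_iff.2 (sub_ne_zero.2 fun h => hcB (h ▸ hy))
  have hΦfar : ∀ y ∈ B, ε / 2 ≤ dist y c → Φ y = y := by
    intro y hy hyc
    rw [dist_eq_norm] at hyc
    simp only [Φ]
    rw [max_eq_left ((div_le_one (hyc0 y hy)).2 hyc), one_smul, add_sub_cancel]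
  have hΦnear : ∀ y ∈ B, dist y c ≤ ε / 2 → Φ y ∈ Metric.sphere c (ε / 2) := by
    intro y hy hyc
    rw [dist_eq_norm] at hyc
    have h1 : 1 ≤ ε / 2 / ‖y - c‖ := (one_le_div (hyc0 y hy)).2 hyc
    simp only [Φ, max_eq_right h1, mem_sphere_iff_norm, add_sub_cancel_left, norm_smul]
    rw [Real.norm_of_nonneg (by positivity), div_mul_cancel₀ _ (hyc0 y hy).ne']
  have hΦc : ContinuousOn Φ B := by
    have h1 : ContinuousOn (fun y => ε / 2 / ‖y - c‖) B :=
      continuousOn_const.div (by fun_prop) fun y hy => (hyc0 y hy).ne'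
    exact continuousOn_const.add (((continuous_const.max continuous_id).comp_continuousOn h1).smul (by fun_prop))
  have hη1 : min (δ / 2) (1 / 10) ≤ 1 / 10 := min_le_right _ _
  have hη2 : min (δ / 2) (1 / 10) ≤ δ / 2 := min_le_left _ _
  obtain ⟨y, hy, hy0⟩ := exists_perturbed_inverse_eq_zero (G := fun y => Q (Φ y) - v) hf
    (fun x hx => by
      have hy : f x ∈ B := mem_image_of_mem f hx
      nth_rewrite 2 [← hGf x hx]
      rcases le_total (ε / 2) (dist (f x) c) with h | h
      · rw [hΦfar _ hy h, sub_right_comm]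
        have h1 := hQG _ (Or.inl hy)
        rw [dist_eq_norm] at h1
        have := norm_sub_le (Q (f x) - G (f x)) v
        linarith
      · have hs := hΦnear _ hy h
        have h1 := hQG _ (Or.inr (Metric.sphere_subset_closedBall hs))
        rw [dist_eq_norm] at h1
        have h2 := hnear _ (Metric.mem_sphere.1 hs).le
        have h3 := hnear _ h
        have e : Q (Φ (f x)) - v - G (f x) =
          (Q (Φ (f x)) - G (Φ (f x))) + G (Φ (f x)) - v - G (f x) := by abel
        have h4 := norm_sub_le ((Q (Φ (f x)) - G (Φ (f x))) + G (Φ (f x)) - v) (G (f x))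
        have h5 := norm_sub_le ((Q (Φ (f x)) - G (Φ (f x))) + G (Φ (f x))) v
        have h6 := norm_add_le (Q (Φ (f x)) - G (Φ (f x))) (G (Φ (f x)))
        rw [e]
        linarith)
    ((hQs.continuous.comp_continuousOn hΦc).sub continuousOn_const)
  rcases le_total (ε / 2) (dist y c) with h | h
  · have h1 := hQG _ (Or.inl hy)
    have h2 := hδG y hy h
    simp only [hΦfar y hy h] at hy0
    rw [sub_eq_zero.1 hy0, dist_eq_norm] at h1
    have h3 := norm_sub_le v (v - G y)
    rw [sub_sub_cancel] at h3
    linarith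
  · exact hvQ ⟨Φ y, hΦnear y hy h, sub_eq_zero.1 hy0⟩

/-- **Invariance of domain** for globally defined injective continuous maps. -/
theorem isOpenMap_of_continuous_injective {f : E → E} (hf : Continuous f)
    (hinj : Function.Injective f) : IsOpenMap f := by
  refine isOpenMap_iff_nhds_le.2 fun a s hs => ?_
  rw [Filter.mem_map] at hs
  obtain ⟨r, hr, hrs⟩ := Metric.nhds_basis_closedBall.mem_iff.1 hs
  have h1 := mem_interior_image_closedBall_one (f := fun x => f (a + r • x)) (by fun_prop)
    (fun x y hxy => smul_right_injective E hr.ne' (add_left_cancel (hinj hxy)))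
  simp only [smul_zero, add_zero] at h1
  refine Filter.mem_of_superset (mem_interior_iff_mem_nhds.1 h1) ?_
  rintro _ ⟨x, hx, rfl⟩
  refine hrs ?_
  rw [mem_closedBall_zero_iff] at hx
  rw [mem_closedBall_iff_norm, add_sub_cancel_left, norm_smul, Real.norm_of_nonneg hr.le]
  exact mul_le_of_le_one_right hr.le hx

end InvarianceOfDomain

/-! ### Set equations, null sets and overlaps for iterated function systems -/

section FamilyImage

variable {d : ℕ} {ι : Type} {f : ι → EuclideanSpace ℝ (Fin d) → EuclideanSpace ℝ (Fin d)}
  {X Y : Set (EuclideanSpace ℝ (Fin d))}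

theorem mem_familyImage {x : EuclideanSpace ℝ (Fin d)} :
    x ∈ familyImage f X ↔ ∃ i, ∃ y ∈ X, f i y = x := by
  simp [familyImage]

theorem familyImage_mono (h : X ⊆ Y) : familyImage f X ⊆ familyImage f Y :=
  iUnion_mono fun _ => image_mono h

theorem familyImage_union :
    familyImage f (X ∪ Y) = familyImage f X ∪ familyImage f Y := by
  simp [familyImage, image_union, iUnion_union_distrib]

theorem familyImage_pairCompositions :
    familyImage (pairCompositions f) X = familyImage f (familyImage f X) := by
  ext x
  simp only [mem_familyImage, pairCompositions, Prod.exists, Function.comp_apply]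
  constructor
  · rintro ⟨i, j, y, hy, rfl⟩
    exact ⟨i, f j y, ⟨j, y, hy, rfl⟩, rfl⟩
  · rintro ⟨i, _, ⟨j, y, hy, rfl⟩, rfl⟩
    exact ⟨i, j, y, hy, rfl⟩

theorem image_subset_familyImage (i : ι) : f i '' X ⊆ familyImage f X :=
  subset_iUnion (fun i => f i '' X) i

theorem IsInsideFamily.familyImage_subset (h : IsInsideFamily f X) : familyImage f X ⊆ X :=
  iUnion_subset h

theorem IsIFS.continuous (hf : IsIFS f) (i : ι) : Continuous (f i) :=
  (hf.2 i).choose_spec.toLipschitzWith.continuous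

theorem IsIFS.isCompact_familyImage (hf : IsIFS f) (hX : IsCompact X) :
    IsCompact (familyImage f X) :=
  have := hf.1
  isCompact_iUnion fun i => hX.image (hf.continuous i)

theorem IsIFS.pairCompositions (hf : IsIFS f) : IsIFS (pairCompositions f) := by
  have := hf.1
  refine ⟨inferInstance, fun p => ?_⟩
  obtain ⟨c, hc⟩ := hf.2 p.1
  obtain ⟨c', hc'⟩ := hf.2 p.2
  exact ⟨c * c', mul_lt_one_of_lt_of_le hc.1 hc'.1.le, hc.2.comp hc'.2⟩

/-- A common contraction factor for all maps of an iterated function system. -/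
theorem IsIFS.exists_lipschitzWith (hf : IsIFS f) :
    ∃ c : NNReal, c < 1 ∧ ∀ i, LipschitzWith c (f i) := by
  have := hf.1
  have := Fintype.ofFinite ι
  choose c hc using hf.2
  refine ⟨Finset.univ.sup c, (Finset.sup_lt_iff (by simp)).2 fun i _ => (hc i).1, fun i => ?_⟩
  exact (hc i).2.weaken (Finset.le_sup (Finset.mem_univ i))

theorem infDist_image_le {g : EuclideanSpace ℝ (Fin d) → EuclideanSpace ℝ (Fin d)} {c : NNReal}
    (hg : LipschitzWith c g) (hY : IsClosed Y) (hYne : Y.Nonempty) (hgY : g '' Y ⊆ Y)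
    (y : EuclideanSpace ℝ (Fin d)) : Metric.infDist (g y) Y ≤ c * Metric.infDist y Y := by
  obtain ⟨z, hz, hyz⟩ := hY.exists_infDist_eq_dist hYne y
  rw [hyz]
  exact (Metric.infDist_le_dist_of_mem (hgY (mem_image_of_mem g hz))).trans (hg.dist_le_mul y z)

/-- Comparison principle for sub- and supersolutions of `K = A ∪ Φ(K)`. -/
theorem IsIFS.subset_of_subset_union (hf : IsIFS f) {A : Set (EuclideanSpace ℝ (Fin d))}
    (hX : IsCompact X) (hXsub : X ⊆ A ∪ familyImage f X) (hY : IsClosed Y) (hYne : Y.Nonempty)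
    (hYsup : A ∪ familyImage f Y ⊆ Y) : X ⊆ Y := by
  rcases X.eq_empty_or_nonempty with rfl | hXne
  · exact empty_subset Y
  obtain ⟨c, hc1, hc⟩ := hf.exists_lipschitzWith
  -- At a point of `X` farthest from `Y`, a contraction bounds the distance by `c < 1` times itself,
  -- so it is zero.
  obtain ⟨x₀, hx₀, hmax⟩ := hX.exists_isMaxOn hXne (Metric.continuous_infDist_pt Y).continuousOn
  have hle : Metric.infDist x₀ Y ≤ 0 := by
    rcases hXsub hx₀ with hA | hΦ
    · exact (Metric.infDist_zero_of_mem (hYsup (Or.inl hA))).le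
    · obtain ⟨i, y, hy, hyx⟩ := mem_familyImage.1 hΦ
      have h1 := infDist_image_le (hc i) hY hYne
        ((image_subset_familyImage i).trans (subset_union_right.trans hYsup)) y
      rw [hyx] at h1
      have h2 : Metric.infDist y Y ≤ Metric.infDist x₀ Y := hmax hy
      have h3 : (c : ℝ) < 1 := by exact_mod_cast hc1
      nlinarith [Metric.infDist_nonneg (x := y) (s := Y), c.2]
  intro x hx
  refine (hY.mem_iff_infDist_zero hYne).2 (le_antisymm ?_ Metric.infDist_nonneg)
  exact le_trans (hmax hx) hle

theorem IsAttractor.subset_of_familyImage_subset {E : Set (EuclideanSpace ℝ (Fin d))}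
    (hE : IsAttractor f E) (hf : IsIFS f) (hY : IsClosed Y) (hYne : Y.Nonempty)
    (hYsub : familyImage f Y ⊆ Y) : E ⊆ Y :=
  hf.subset_of_subset_union (A := ∅) hE.2.1 (by rw [empty_union]; exact hE.2.2.le) hY hYne
    (by rwa [empty_union])

/-- The iterated images of a compact set shrink to the attractor. -/
theorem IsAttractor.iInter_iterate_subset {E : Set (EuclideanSpace ℝ (Fin d))}
    (hE : IsAttractor f E) (hf : IsIFS f) (hX : IsCompact X) :
    ⋂ n : ℕ, (familyImage f)^[n] X ⊆ E := by
  obtain ⟨c, hc1, hc⟩ := hf.exists_lipschitzWith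
  obtain ⟨M, hM⟩ := hX.bddAbove_image (Metric.continuous_infDist_pt E).continuousOn
  have hbound : ∀ n : ℕ, ∀ x ∈ (familyImage f)^[n] X, Metric.infDist x E ≤ c ^ n * M := by
    intro n
    induction n with
    | zero => intro x hx; simpa using hM (mem_image_of_mem _ hx)
    | succ n ih =>
      intro x hx
      rw [Function.iterate_succ_apply'] at hx
      obtain ⟨i, y, hy, rfl⟩ := mem_familyImage.1 hx
      refine (infDist_image_le (hc i) hE.2.1.isClosed hE.1
        ((image_subset_familyImage i).trans hE.2.2.ge) y).trans ?_
      rw [pow_succ', mul_assoc]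
      exact mul_le_mul_of_nonneg_left (ih y hy) c.2
  intro x hx
  refine (hE.2.1.isClosed.mem_iff_infDist_zero hE.1).2 (le_antisymm ?_ Metric.infDist_nonneg)
  have hlim : Filter.Tendsto (fun n : ℕ => (c : ℝ) ^ n * M) Filter.atTop (nhds 0) := by
    simpa using (tendsto_pow_atTop_nhds_zero_of_lt_one c.2
      (by exact_mod_cast hc1)).mul_const M
  exact ge_of_tendsto' hlim fun n => hbound n x (mem_iInter.1 hx n)

/-- In dimension `d`, Hausdorff measure is a Haar measure, hence has the null sets of `volume`, and
Lipschitz maps scale it by a bounded factor. -/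
theorem LipschitzWith.volume_image_eq_zero
    {g : EuclideanSpace ℝ (Fin d) → EuclideanSpace ℝ (Fin d)} {c : NNReal}
    (hg : LipschitzWith c g) (hX : volume X = 0) : volume (g '' X) = 0 := by
  have hfin : Module.finrank ℝ (EuclideanSpace ℝ (Fin d)) = d := by simp
  have hH : (Measure.hausdorffMeasure (d : ℝ) : Measure (EuclideanSpace ℝ (Fin d))).IsAddHaarMeasure := by
    have := isAddHaarMeasure_hausdorffMeasure (E := EuclideanSpace ℝ (Fin d))
    rwa [hfin] at this
  have h1 : Measure.hausdorffMeasure (d : ℝ) X = 0 :=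
    Measure.absolutelyContinuous_isAddHaarMeasure _ volume hX
  have h2 := hg.hausdorffMeasure_image_le (d := d) (Nat.cast_nonneg d) X
  rw [h1, mul_zero, nonpos_iff_eq_zero] at h2
  exact Measure.absolutelyContinuous_isAddHaarMeasure volume _ h2

theorem IsIFS.volume_familyImage_eq_zero (hf : IsIFS f) (hX : volume X = 0) :
    volume (familyImage f X) = 0 := by
  have := hf.1
  exact measure_iUnion_null fun i => (hf.2 i).choose_spec.2.volume_image_eq_zero hX

/-- A set contained, up to a null set, in its own image is null if the attractor is null. -/
theorem IsAttractor.volume_eq_zero_of_subset_union {E Z : Set (EuclideanSpace ℝ (Fin d))}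
    (hE : IsAttractor f E) (hE0 : volume E = 0) (hf : IsIFS f) (hY : IsCompact Y) (hXY : X ⊆ Y)
    (hZ : volume Z = 0) (hXZ : X ⊆ Z ∪ familyImage f X) : volume X = 0 := by
  have hZn : ∀ n : ℕ, ∃ W, volume W = 0 ∧ X ⊆ W ∪ (familyImage f)^[n] X := by
    intro n
    induction n with
    | zero => exact ⟨∅, measure_empty, subset_union_right⟩
    | succ n ih =>
      obtain ⟨W, hW, hXW⟩ := ih
      refine ⟨Z ∪ familyImage f W, measure_union_null hZ (hf.volume_familyImage_eq_zero hW), ?_⟩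
      rw [Function.iterate_succ_apply', union_assoc, ← familyImage_union]
      exact hXZ.trans (union_subset_union_right _ (familyImage_mono hXW))
  choose W hW hXW using hZn
  have hmono : ∀ n : ℕ, (familyImage f)^[n] X ⊆ (familyImage f)^[n] Y := fun n =>
    Monotone.iterate (fun _ _ h => familyImage_mono h) n hXY
  refine measure_mono_null (t := (⋃ n, W n) ∪ E) (fun x hx => ?_)
    (measure_union_null (measure_iUnion_null hW) hE0)
  by_cases hxW : x ∈ ⋃ n, W n
  · exact Or.inl hxW
  · refine Or.inr (hE.iInter_iterate_subset hf hY (mem_iInter.2 fun n => hmono n ?_))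
    exact (hXW n hx).resolve_left fun h => hxW (mem_iUnion.2 ⟨n, h⟩)

/-- An open set covered, up to a null set, by a closed set is contained in it. -/
theorem IsOpen.subset_of_volume_diff_eq_zero (hX : IsOpen X) (hY : IsClosed Y)
    (h : volume (X \ Y) = 0) : X ⊆ Y := by
  have := (hX.sdiff hY).measure_eq_zero_iff volume |>.1 h
  exact sdiff_eq_empty.1 this

theorem image_subset_closure_interior_image {g : EuclideanSpace ℝ (Fin d) → EuclideanSpace ℝ (Fin d)}
    (hg : Continuous g) (hgo : IsOpenMap g) (hX : closure (interior X) = X) :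
    g '' X ⊆ closure (interior (g '' X)) := by
  conv_lhs => rw [← hX]
  exact (image_closure_subset_closure_image hg).trans
    (closure_mono (hgo.image_interior_subset X))

variable {D : Set (EuclideanSpace ℝ (Fin d))}

theorem closure_diff_subset_closure_interior {W : Set (EuclideanSpace ℝ (Fin d))}
    (hD : closure (interior D) = D) (hW : IsClosed W) :
    closure (D \ W) ⊆ closure (interior (closure (D \ W))) := by
  refine closure_minimal ?_ isClosed_closure
  have h1 : D \ W ⊆ closure (interior D ∩ Wᶜ) := by
    intro x hx
    have hx1 : x ∈ closure (interior D) := hD.symm ▸ hx.1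
    exact hW.isOpen_compl.closure_inter ⟨hx1, hx.2⟩
  refine h1.trans (closure_mono (interior_maximal ?_ (isOpen_interior.inter hW.isOpen_compl)))
  exact fun x hx => subset_closure ⟨interior_subset hx.1, hx.2⟩

/-- The condensation set meets the image family only in a null set. -/
theorem volume_closure_diff_inter_familyImage (hf : IsIFS f) (hfo : ∀ i, IsOpenMap (f i))
    (hDc : IsCompact D) (hDbd : volume (frontier D) = 0) :
    volume (closure (D \ familyImage f D) ∩ familyImage f D) = 0 := by
  refine measure_mono_null ?_ (hf.volume_familyImage_eq_zero hDbd)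
  rintro x ⟨hx, hxΦ⟩
  obtain ⟨i, y, hy, rfl⟩ := mem_familyImage.1 hxΦ
  refine mem_familyImage.2 ⟨i, y, ?_, rfl⟩
  rw [hDc.isClosed.frontier_eq]
  refine ⟨hy, fun hyi => ?_⟩
  obtain ⟨z, hz, hz'⟩ := mem_closure_iff.1 hx _ (hfo i _ isOpen_interior)
    (mem_image_of_mem (f i) hyi)
  exact hz'.2 (image_subset_familyImage i (image_mono interior_subset hz))

/-- Double images of `X` meet single images only in overlaps of the family on `D` and in images of
the overlap of `X` with its images. -/
theorem familyImage_familyImage_inter_subset (hinj : ∀ i, Function.Injective (f i))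
    (hinside : IsInsideFamily f D) (hXD : X ⊆ D) :
    familyImage f (familyImage f X) ∩ familyImage f X ⊆
      (⋃ i, ⋃ j, ⋃ (_ : i ≠ j), f i '' D ∩ f j '' D) ∪ familyImage f (X ∩ familyImage f X) := by
  rintro x ⟨hx1, hx2⟩
  obtain ⟨i, y, hy, hyx⟩ := mem_familyImage.1 hx1
  obtain ⟨j, z, hz, hzx⟩ := mem_familyImage.1 hx2
  by_cases hij : i = j
  · subst hij
    have hyz : y = z := hinj i (hyx.trans hzx.symm)
    subst hyz
    exact Or.inr (mem_familyImage.2 ⟨i, y, ⟨hz, hy⟩, hyx⟩)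
  · have hyD : y ∈ D := hinside.familyImage_subset (familyImage_mono hXD hy)
    simp only [mem_union, mem_iUnion]
    exact Or.inl ⟨i, j, hij, ⟨y, hyD, hyx⟩, ⟨z, hXD hz, hzx⟩⟩

theorem IsNonOverlappingFamily.volume_iUnion_eq_zero (h : IsNonOverlappingFamily f D)
    (hf : IsIFS f) : volume (⋃ i, ⋃ j, ⋃ (_ : i ≠ j), f i '' D ∩ f j '' D) = 0 := by
  have := hf.1
  exact measure_iUnion_null fun i => measure_iUnion_null fun j => measure_iUnion_null (h i j)

/-- The solution of `K = B ∪ Ψ(K)` generated by `B`, for `B` inside an invariant compact set. -/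
theorem IsIFS.exists_isCompact_eq_union (hf : IsIFS f) {B : Set (EuclideanSpace ℝ (Fin d))}
    (hD : IsCompact D) (hinside : familyImage f D ⊆ D) (hBc : IsClosed B) (hB : B ⊆ D) :
    ∃ K ⊆ D, IsCompact K ∧ K = B ∪ familyImage f K := by
  have hfin := hf.1
  let T : ℕ → Set (EuclideanSpace ℝ (Fin d)) := fun n => (familyImage f)^[n] B
  have hT : ∀ n, T (n + 1) = familyImage f (T n) := fun n => Function.iterate_succ_apply' _ n B
  have hTD : ∀ n, T n ⊆ D := by
    intro n
    induction n with
    | zero => exact hB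
    | succ n ih => rw [hT]; exact (familyImage_mono ih).trans hinside
  have hKD : closure (⋃ n, T n) ⊆ D := closure_minimal (iUnion_subset hTD) hD.isClosed
  have hKc : IsCompact (closure (⋃ n, T n)) := hD.of_isClosed_subset isClosed_closure hKD
  refine ⟨_, hKD, hKc, Subset.antisymm ?_ (union_subset ?_ ?_)⟩
  · refine closure_minimal (iUnion_subset fun n => ?_)
      (hBc.union (hf.isCompact_familyImage hKc).isClosed)
    cases n with
    | zero => exact subset_union_left
    | succ n =>
      rw [hT]
      exact (familyImage_mono ((subset_iUnion T n).trans subset_closure)).trans subset_union_right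
  · exact (subset_iUnion T 0).trans subset_closure
  · refine iUnion_subset fun i => ?_
    refine (image_closure_subset_closure_image (hf.continuous i)).trans (closure_mono ?_)
    rw [image_iUnion]
    refine iUnion_subset fun n => ?_
    refine Subset.trans ?_ (subset_iUnion T (n + 1))
    rw [hT]
    exact image_subset_familyImage i

end FamilyImage

/-! ### Necessary conditions on a generator -/

section Dissection

variable {d : ℕ} {ι : Type} {f : ι → EuclideanSpace ℝ (Fin d) → EuclideanSpace ℝ (Fin d)}
  {D E X : Set (EuclideanSpace ℝ (Fin d))}

theorem IsDissectionGenerator.subset (h : IsDissectionGenerator f D X) : X ⊆ D :=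
  subset_union_left.trans h.2.2.1.ge

theorem IsDissectionGenerator.volume_inter_familyImage (h : IsDissectionGenerator f D X)
    (hf : IsIFS f) : volume (X ∩ familyImage f X) = 0 := by
  have := hf.1
  rw [familyImage, inter_iUnion]
  exact measure_iUnion_null h.2.2.2.2

theorem IsDissectionGenerator.closure_diff_subset (h : IsDissectionGenerator f D X) :
    closure (D \ familyImage f D) ⊆ X := by
  refine closure_minimal (fun x hx => ?_) h.1.isClosed
  have hx' : x ∈ X ∪ familyImage f X := h.2.2.1 ▸ hx.1
  exact hx'.resolve_right fun hΦ => hx.2 (familyImage_mono h.subset hΦ)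

/-- Points of a double image outside `X` lie in `Φ(X)`, and that overlap is null. The interior of
each double image therefore lies in `X`, and regular closedness extends this to the whole image. -/
theorem IsDissectionGenerator.familyImage_familyImage_subset (h : IsDissectionGenerator f D X)
    (hf : IsIFS f) (hinj : ∀ i, Function.Injective (f i)) (hfo : ∀ i, IsOpenMap (f i))
    (hinside : IsInsideFamily f D) (hnonover : IsNonOverlappingFamily f D) :
    familyImage f (familyImage f X) ⊆ X := by
  have hnull : volume (familyImage f (familyImage f X) ∩ familyImage f X) = 0 :=
    measure_mono_null (familyImage_familyImage_inter_subset hinj hinside h.subset)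
      (measure_union_null (hnonover.volume_iUnion_eq_zero hf)
        (hf.volume_familyImage_eq_zero (h.volume_inter_familyImage hf)))
  rw [← familyImage_pairCompositions]
  refine iUnion_subset fun p => ?_
  refine (image_subset_closure_interior_image ((hf.continuous p.1).comp (hf.continuous p.2))
    ((hfo p.1).comp (hfo p.2)) h.2.1).trans (closure_minimal ?_ h.1.isClosed)
  refine isOpen_interior.subset_of_volume_diff_eq_zero h.1.isClosed (measure_mono_null ?_ hnull)
  rintro x ⟨hx, hxX⟩
  have hx2 : x ∈ familyImage f (familyImage f X) := by
    rw [← familyImage_pairCompositions]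
    exact image_subset_familyImage (f := pairCompositions f) p (interior_subset hx)
  have hxD : x ∈ X ∪ familyImage f X := by
    rw [← h.2.2.1]
    exact hinside.familyImage_subset (familyImage_mono
      ((familyImage_mono h.subset).trans hinside.familyImage_subset) hx2)
  exact ⟨hx2, hxD.resolve_left hxX⟩

end Dissection

/-! ### Existence, uniqueness and the attractor property -/

theorem mainTheorem6 {d k : ℕ} (D E : Set (EuclideanSpace ℝ (Fin d)))
    (f : Fin k → EuclideanSpace ℝ (Fin d) → EuclideanSpace ℝ (Fin d))
    (hDne : D.Nonempty) (hDc : IsCompact D) (hDreg : closure (interior D) = D)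
    (hDbd : volume (frontier D) = 0)
    (hinj : ∀ i, Function.Injective (f i)) (hf : IsIFS f)
    (hinside : IsInsideFamily f D) (hnonover : IsNonOverlappingFamily f D)
    (hE : IsAttractor f E) (hE0 : volume E = 0) :
    IsCondensationIFS (pairCompositions f) (closure (D \ familyImage f D) ∪ E) ∧
    ∃ X : Set (EuclideanSpace ℝ (Fin d)),
      (IsDissectionGenerator f D X ∧
        ∀ X', IsDissectionGenerator f D X' → X' = X) ∧
      (IsCondensationAttractor (pairCompositions f)
          (closure (D \ familyImage f D) ∪ E) X ∧
        ∀ K, IsCondensationAttractor (pairCompositions f)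
          (closure (D \ familyImage f D) ∪ E) K → K = X) := by
  have hfo : ∀ i, IsOpenMap (f i) := fun i =>
    isOpenMap_of_continuous_injective (hf.continuous i) (hinj i)
  have hΨ := hf.pairCompositions
  have hΦD := hinside.familyImage_subset
  have hΨD : familyImage (pairCompositions f) D ⊆ D := by
    rw [familyImage_pairCompositions]
    exact (familyImage_mono hΦD).trans hΦD
  have hΦDc := (hf.isCompact_familyImage hDc).isClosed
  set B := closure (D \ familyImage f D) with hB
  have hBD : B ⊆ D := closure_minimal sdiff_subset hDc.isClosed
  have hBc : IsCompact B := hDc.of_isClosed_subset isClosed_closure hBD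
  -- Otherwise `D ⊆ Φ(D)`, so comparison puts `D`, which has interior, into the null set `E`.
  have hBne : B.Nonempty := by
    refine Nonempty.closure (nonempty_iff_ne_empty.2 fun hempty => ?_)
    have hDE : D ⊆ E := hf.subset_of_subset_union (A := ∅) hDc
      (by rw [empty_union]; exact sdiff_eq_empty.1 hempty) hE.2.1.isClosed hE.1
      (by rw [empty_union]; exact hE.2.2.ge)
    have hint : (interior D).Nonempty := by
      rw [← closure_nonempty_iff, hDreg]
      exact hDne
    exact (isOpen_interior.measure_pos volume hint).ne'
      (measure_mono_null (interior_subset.trans hDE) hE0)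
  obtain ⟨X, hXD, hXc, hX⟩ := hΨ.exists_isCompact_eq_union hDc hΨD hBc.isClosed hBD
  have hBX : B ⊆ X := subset_union_left.trans hX.ge
  have hΨX : familyImage (pairCompositions f) X ⊆ X := subset_union_right.trans hX.ge
  have hXne : X.Nonempty := hBne.mono hBX
  have hEΨ : IsAttractor (pairCompositions f) E :=
    ⟨hE.1, hE.2.1, by rw [familyImage_pairCompositions, ← hE.2.2, ← hE.2.2]⟩
  have hEX : E ⊆ X := hEΨ.subset_of_familyImage_subset hΨ hXc.isClosed hXne hΨX
  have hXattr : X = (B ∪ E) ∪ familyImage (pairCompositions f) X :=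
    Subset.antisymm (hX.le.trans (union_subset_union_left _ subset_union_left))
      (union_subset (union_subset hBX hEX) hΨX)
  have hXmin : ∀ Y, IsClosed Y → B ⊆ Y → familyImage f (familyImage f Y) ⊆ Y → X ⊆ Y := by
    intro Y hY hBY hΨY
    rw [← familyImage_pairCompositions] at hΨY
    exact hΨ.subset_of_subset_union hXc hX.le hY (hBne.mono hBY) (union_subset hBY hΨY)
  have hXreg : closure (interior X) = X := by
    refine Subset.antisymm (closure_minimal interior_subset hXc.isClosed) ?_
    refine hXmin _ isClosed_closure ((closure_diff_subset_closure_interior hDreg hΦDc).trans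
      (closure_mono (interior_mono hBX))) ?_
    rw [← familyImage_pairCompositions]
    refine iUnion_subset fun p => ?_
    refine (image_closure_subset_closure_image
      ((hf.continuous p.1).comp (hf.continuous p.2))).trans (closure_mono ?_)
    refine (((hfo p.1).comp (hfo p.2)).image_interior_subset X).trans (interior_mono ?_)
    exact (image_subset_familyImage (f := pairCompositions f) p).trans hΨX
  have hcover : D = X ∪ familyImage f X := by
    refine Subset.antisymm ?_ (union_subset hXD ((familyImage_mono hXD).trans hΦD))
    -- Comparison for `K = B ∪ Φ(K)`: `D` is a subsolution and `X ∪ Φ(X)` a supersolution.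
    refine hf.subset_of_subset_union (A := B) hDc (fun x hx => ?_)
      (hXc.union (hf.isCompact_familyImage hXc)).isClosed (hXne.mono subset_union_left) ?_
    · by_cases hxΦ : x ∈ familyImage f D
      · exact Or.inr hxΦ
      · exact Or.inl (subset_closure ⟨hx, hxΦ⟩)
    · rw [familyImage_union, ← familyImage_pairCompositions]
      exact union_subset (hBX.trans subset_union_left)
        (union_subset subset_union_right (hΨX.trans subset_union_left))
  have hXnull : volume (X ∩ familyImage f X) = 0 := by
    refine hE.volume_eq_zero_of_subset_union hE0 hf hDc (inter_subset_left.trans hXD)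
      (measure_union_null (volume_closure_diff_inter_familyImage hf hfo hDc hDbd)
        (hnonover.volume_iUnion_eq_zero hf)) ?_
    rintro x ⟨hxX, hxΦ⟩
    rw [hX, familyImage_pairCompositions] at hxX
    rcases hxX with hxB | hxΨ
    · exact Or.inl (Or.inl ⟨hxB, familyImage_mono hXD hxΦ⟩)
    · exact (familyImage_familyImage_inter_subset hinj hinside hXD ⟨hxΨ, hxΦ⟩).imp_left Or.inr
  refine ⟨⟨hΨ, hBne.mono subset_union_left, hBc.union hE.2.1⟩, X, ⟨⟨hXc, hXreg, hcover, ?_, ?_⟩, ?_⟩,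
    ⟨hXne, hXc, hXattr⟩, ?_⟩
  · exact fun i j hij => measure_mono_null
      (inter_subset_inter (image_mono hXD) (image_mono hXD)) (hnonover i j hij)
  · exact fun i => measure_mono_null
      (inter_subset_inter_right X (image_subset_familyImage i)) hXnull
  · intro X' hX'
    have hsub : X ⊆ X' := hXmin X' hX'.1.isClosed hX'.closure_diff_subset
      (hX'.familyImage_familyImage_subset hf hinj hfo hinside hnonover)
    refine Subset.antisymm ?_ hsub
    rw [← hX'.2.1]
    refine closure_minimal (isOpen_interior.subset_of_volume_diff_eq_zero hXc.isClosed
      (measure_mono_null ?_ (hX'.volume_inter_familyImage hf))) hXc.isClosed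
    rintro x ⟨hx, hxX⟩
    have hxD : x ∈ X ∪ familyImage f X := hcover ▸ hX'.subset (interior_subset hx)
    exact ⟨interior_subset hx, familyImage_mono hsub (hxD.resolve_left hxX)⟩
  · rintro K ⟨hKne, hKc, hK⟩
    exact Subset.antisymm
      (hΨ.subset_of_subset_union hKc hK.le hXc.isClosed hXne hXattr.ge)
      (hΨ.subset_of_subset_union hXc hXattr.le hKc.isClosed hKne hK.ge)
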